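/- Let $m\ge 3$, let $X_k=(x^{(k)}_{ij})_{1\le i,j\le 2}$ for $k=1,\dots,m$ be $2\times 2$ matrices of independent indeterminates, and let $R=\mathbb{C}[x^{(k)}_{ij}]$. Let $\operatorname{Sing}_{2,m}\subseteq(\mathbb{C}^{2\times 2})^m$ be the set of all tuples $(A_1,\dots,A_m)$ such that $\sum_{k}\lambda_kA_k$ is singular for every $\lambda\in\mathbb{Q}^m$. Let $I=I(\operatorname{Sing}_{2,m})\subseteq R$ be the ideal of all polynomials vanishing on $\operatorname{Sing}_{2,m}$, let $I_2$ be the $\mathbb{C}$-vector space of its homogeneous elements of degree $2$ (including $0$), and let $J\subseteq R$ be the ideal generated by $I_2$. Then: 1. $I_2$ is the $\mathbb{C}$-linear span of the quadrics $\det(\lambda_1X_1+\dots+\lambda_mX_m)$, $\lambda\in\mathbb{C}^m$; hence $J$ is the ideal generated by these quadrics. 2. $J$ is not a radical ideal. 3. $I=\sqrt{J}$. 4. $I$ is generated by $I_2$ together with all $3\times 3$ minors of the flattening $\mathbb{C}^m\to\mathbb{C}^2\otimes\mathbb{C}^2$, $e_k\mapsto X_k$, that is, of the $4\times m$ matrix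 whose $k$-th column consists of the four entries of $X_k$. -/

import Mathlib

open MvPolynomial

/-- The coordinates `x_{ij}^{(k)}` on `m`-tuples of `n × n` matrices, indexed by `(k, i, j)`. -/
abbrev TupleVar (n m : ℕ) : Type := Fin m × Fin n × Fin n

/-- The `k`-th matrix of the tuple with coordinate vector `x`. With `x = X` (the indeterminates)
this is the `k`-th generic matrix. -/
def tupleMatrix {R : Type*} {n m : ℕ} (x : TupleVar n m → R) (k : Fin m) :
    Matrix (Fin n) (Fin n) R :=
  Matrix.of fun i j => x (k, i, j)

/-- The variety of `m`-tuples of complex `n × n` matrices all of whose rational linear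
combinations are singular. -/
def singVariety (n m : ℕ) : Set (TupleVar n m → ℂ) :=
  {x | ∀ c : Fin m → ℚ, (∑ k, (c k : ℂ) • tupleMatrix x k).det = 0}

/-- The ideal of all complex polynomials vanishing on `singVariety n m`. -/
noncomputable def singIdeal (n m : ℕ) : Ideal (MvPolynomial (TupleVar n m) ℂ) :=
  vanishingIdeal ℂ (singVariety n m)

/-- The degree `d` component of `singIdeal n m`, as a complex vector space. -/
noncomputable def singIdealComponent (n m d : ℕ) :
    Submodule ℂ (MvPolynomial (TupleVar n m) ℂ) :=
  (singIdeal n m).restrictScalars ℂ ⊓ homogeneousSubmodule (TupleVar n m) ℂ d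

/-- The form `det (c₁ X₁ + ⋯ + c_m X_m)` in the generic matrices `X₁, …, X_m`. -/
noncomputable def detForm (n m : ℕ) (c : Fin m → ℂ) : MvPolynomial (TupleVar n m) ℂ :=
  (∑ k, (C (c k) : MvPolynomial (TupleVar n m) ℂ) • tupleMatrix X k).det

/-- The generic matrix of the flattening `ℂ^m → ℂ^n ⊗ ℂ^n`, `e_k ↦ X_k`: its `k`-th column lists
the entries of the `k`-th generic matrix. -/
noncomputable def flattening (n m : ℕ) :
    Matrix (Fin n × Fin n) (Fin m) (MvPolynomial (TupleVar n m) ℂ) :=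
  Matrix.of fun ij k => X (k, ij.1, ij.2)

/-- The `r × r` minors (up to sign) of the flattening. -/
def flatteningMinors (n m r : ℕ) : Set (MvPolynomial (TupleVar n m) ℂ) :=
  {p | ∃ (a : Fin r ↪ Fin n × Fin n) (b : Fin r ↪ Fin m),
    p = ((flattening n m).submatrix a b).det}

/-! The determinant on `2 × 2` matrices is a nondegenerate quadratic form on a four-dimensional
space, and the singular tuples are those whose span is totally isotropic. Such a span has dimension
at most 2, so the `3 × 3` minors of the flattening vanish on the variety.

For the converse inclusion, let `K` be the ideal generated by the quadrics and the minors, and write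
a monomial as a word of matrix indices, row indices and column indices. Modulo `K`, the effect of
permuting the row word does not depend on the column word up to permutation
(`of_polarDet_of_minors`). Averaging over both permutations writes each monomial as a row average
plus a column correction (`wordProd_eq_averages`). The former depends only on the image of the
monomial under `rowSplit`, the latter only on its image under `colSplit`, so the quotient map is a
sum of linear maps factoring through these two parametrizations
(`algHom_eq_zero_of_rowSplit_of_colSplit`). Both parametrize singular tuples, hence kill every
polynomial of the vanishing ideal, which therefore lies in `K`.

The degree 2 part follows because the minors are cubic, and the radical statement is the
Nullstellensatz. Nonradicality is seen over a nonreduced ring: a point there satisfies all the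
quadrics but not one of the minors. -/

section WordRelations

/-! ### Exchange relations between row and column words. -/

variable {m : ℕ} {A : Type*} [CommRing A]

/-- The polar form of the determinant of `2 × 2` matrices, on the `k`-th and `l`-th matrices. -/
def polarDet (x : TupleVar 2 m → A) (k l : Fin m) : A :=
  x (k, 0, 0) * x (l, 1, 1) + x (l, 0, 0) * x (k, 1, 1) -
    x (k, 0, 1) * x (l, 1, 0) - x (l, 0, 1) * x (k, 1, 0)

/-- The product of the coordinates listed by the words `k`, `p`, `q`. -/
def wordProd (x : TupleVar 2 m → A) {n : ℕ} (k : Fin n → Fin m) (p q : Fin n → Fin 2) : A :=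
  ∏ t, x (k t, p t, q t)

theorem swap_rows_swap_cols_same {x : TupleVar 2 m → A} (hdet : ∀ k l, polarDet x k l = 0)
    (k l : Fin m) (p p' q q' : Fin 2) :
    x (k, p', q') * x (l, p, q) - x (k, p', q) * x (l, p, q') -
      x (k, p, q') * x (l, p', q) + x (k, p, q) * x (l, p', q') = 0 := by
  have h := hdet k l
  unfold polarDet at h
  fin_cases p <;> fin_cases p' <;> fin_cases q <;> fin_cases q' <;> simp only [Fin.zero_eta,
    Fin.mk_one, Fin.isValue] <;>
    first | ring1 | linear_combination h | linear_combination -h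

/-- Cubic relation for a row swap and a column swap sharing only the position of `k`. This is where
the minors are needed: twice the left side is a combination of one minor and three multiples of
polar forms. -/
theorem swap_rows_swap_cols_overlap_basic [Algebra ℂ A] {x : TupleVar 2 m → A}
    (hdet : ∀ k l, polarDet x k l = 0)
    (hminor : ∀ (a : Fin 3 → Fin 2 × Fin 2) (b : Fin 3 → Fin m),
      (Matrix.of fun i j => x (b j, (a i).1, (a i).2)).det = 0)
    (k l j : Fin m) (p q : Fin 2) :
    x (k, 1, 1) * x (l, 0, q) * x (j, p, 0) - x (k, 1, 0) * x (l, 0, q) * x (j, p, 1) -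
      x (k, 0, 1) * x (l, 1, q) * x (j, p, 0) + x (k, 0, 0) * x (l, 1, q) * x (j, p, 1) = 0 := by
  have two_cancel : ∀ z : A, 2 * z = 0 → z = 0 := fun z hz => by
    have : (2 : ℂ) • z = 0 := by rw [Algebra.smul_def, map_ofNat, hz]
    simpa using this
  have h₁ := hdet l j
  have h₂ := hdet k j
  have h₃ := hdet k l
  have hm := fun a => hminor a ![k, l, j]
  simp only [Matrix.det_fin_three, Matrix.of_apply, Matrix.cons_val] at hm
  unfold polarDet at h₁ h₂ h₃
  apply two_cancel
  fin_cases p <;> fin_cases q <;> simp only [Fin.zero_eta, Fin.mk_one, Fin.isValue]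
  · have h := hm ![(0, 0), (0, 1), (1, 0)]
    simp only [Matrix.cons_val] at h
    linear_combination -x (k, 0, 0) * h₁ + x (l, 0, 0) * h₂ + x (j, 0, 0) * h₃ - h
  · have h := hm ![(0, 0), (0, 1), (1, 1)]
    simp only [Matrix.cons_val] at h
    linear_combination -x (k, 0, 1) * h₁ + x (l, 0, 1) * h₂ + x (j, 0, 1) * h₃ - h
  · have h := hm ![(0, 0), (1, 0), (1, 1)]
    simp only [Matrix.cons_val] at h
    linear_combination -x (k, 1, 0) * h₁ + x (l, 1, 0) * h₂ + x (j, 1, 0) * h₃ + h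
  · have h := hm ![(0, 1), (1, 0), (1, 1)]
    simp only [Matrix.cons_val] at h
    linear_combination -x (k, 1, 1) * h₁ + x (l, 1, 1) * h₂ + x (j, 1, 1) * h₃ + h

theorem swap_rows_swap_cols_overlap [Algebra ℂ A] {x : TupleVar 2 m → A}
    (hdet : ∀ k l, polarDet x k l = 0)
    (hminor : ∀ (a : Fin 3 → Fin 2 × Fin 2) (b : Fin 3 → Fin m),
      (Matrix.of fun i j => x (b j, (a i).1, (a i).2)).det = 0)
    (k l j : Fin m) (p p' p'' q q' q'' : Fin 2) :
    x (k, p', q'') * x (l, p, q') * x (j, p'', q) - x (k, p', q) * x (l, p, q') * x (j, p'', q'') -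
      x (k, p, q'') * x (l, p', q') * x (j, p'', q) +
      x (k, p, q) * x (l, p', q') * x (j, p'', q'') = 0 := by
  have h := swap_rows_swap_cols_overlap_basic hdet hminor k l j p'' q'
  fin_cases p <;> fin_cases p' <;> fin_cases q <;> fin_cases q'' <;> simp only [Fin.zero_eta,
    Fin.mk_one, Fin.isValue] <;>
    first | ring1 | linear_combination h | linear_combination -h

theorem wordProd_eq_mul_two (x : TupleVar 2 m → A) {n : ℕ} (k : Fin n → Fin m)
    (p q : Fin n → Fin 2) {s t : Fin n} (hst : s ≠ t) :
    wordProd x k p q = x (k s, p s, q s) * x (k t, p t, q t) *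
      ∏ i ∈ (Finset.univ.erase s).erase t, x (k i, p i, q i) := by
  rw [wordProd, ← Finset.mul_prod_erase _ _ (Finset.mem_univ s),
    ← Finset.mul_prod_erase _ _ (Finset.mem_erase.2 ⟨hst.symm, Finset.mem_univ t⟩), mul_assoc]

theorem wordProd_eq_mul_three (x : TupleVar 2 m → A) {n : ℕ} (k : Fin n → Fin m)
    (p q : Fin n → Fin 2) {s t u : Fin n} (hst : s ≠ t) (hsu : s ≠ u) (htu : t ≠ u) :
    wordProd x k p q = x (k s, p s, q s) * x (k t, p t, q t) * x (k u, p u, q u) *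
      ∏ i ∈ ((Finset.univ.erase s).erase t).erase u, x (k i, p i, q i) := by
  rw [wordProd_eq_mul_two x k p q hst, ← Finset.mul_prod_erase ((Finset.univ.erase s).erase t) _
    (Finset.mem_erase.2 ⟨htu.symm, Finset.mem_erase.2 ⟨hsu.symm, Finset.mem_univ u⟩⟩)]
  ring

/-- The mixed second difference of `wordProd` under the permutation `σ` of the row word and `τ` of
the column word vanishes, whatever the row and column words. -/
def MixedDiffVanishes (x : TupleVar 2 m → A) {n : ℕ} (k : Fin n → Fin m)
    (σ τ : Equiv.Perm (Fin n)) : Prop :=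
  ∀ p q : Fin n → Fin 2, wordProd x k (p ∘ σ) (q ∘ τ) - wordProd x k (p ∘ σ) q -
    wordProd x k p (q ∘ τ) + wordProd x k p q = 0

namespace MixedDiffVanishes

variable {x : TupleVar 2 m → A} {n : ℕ} {k : Fin n → Fin m} {σ σ' τ τ' : Equiv.Perm (Fin n)}

theorem one_left : MixedDiffVanishes x k 1 τ := fun p q => by simp

theorem one_right : MixedDiffVanishes x k σ 1 := fun p q => by simp

/-- Mixed differences telescope along a product of permutations. Quantifying over all words lets the
second factor act on the already permuted word. -/
theorem mul_left (h : MixedDiffVanishes x k σ τ) (h' : MixedDiffVanishes x k σ' τ) :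
    MixedDiffVanishes x k (σ * σ') τ := fun p q => by
  have h₁ := h p q
  have h₂ := h' (p ∘ σ) q
  rw [Function.comp_assoc, ← Equiv.Perm.coe_mul] at h₂
  linear_combination h₁ + h₂

theorem mul_right (h : MixedDiffVanishes x k σ τ) (h' : MixedDiffVanishes x k σ τ') :
    MixedDiffVanishes x k σ (τ * τ') := fun p q => by
  have h₁ := h p q
  have h₂ := h' p (q ∘ τ)
  rw [Function.comp_assoc, ← Equiv.Perm.coe_mul] at h₂
  linear_combination h₁ + h₂

theorem swap_swap_same (hdet : ∀ k l, polarDet x k l = 0) {s t : Fin n} (hst : s ≠ t) :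
    MixedDiffVanishes x k (Equiv.swap s t) (Equiv.swap s t) := fun p q => by
  have hrest : ∀ p' q' : Fin n → Fin 2, (∀ i, i ≠ s → i ≠ t → p' i = p i) →
      (∀ i, i ≠ s → i ≠ t → q' i = q i) →
      wordProd x k p' q' = x (k s, p' s, q' s) * x (k t, p' t, q' t) *
        ∏ i ∈ (Finset.univ.erase s).erase t, x (k i, p i, q i) := by
    intro p' q' hp hq
    rw [wordProd_eq_mul_two x k p' q' hst]
    congr 1
    refine Finset.prod_congr rfl fun i hi => ?_
    simp only [Finset.mem_erase] at hi
    rw [hp i hi.2.1 hi.1, hq i hi.2.1 hi.1]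
  have hswap : ∀ (f : Fin n → Fin 2) i, i ≠ s → i ≠ t → (f ∘ Equiv.swap s t) i = f i :=
    fun f i h₁ h₂ => by rw [Function.comp_apply, Equiv.swap_apply_of_ne_of_ne h₁ h₂]
  rw [hrest _ _ (hswap p) (hswap q), hrest _ _ (hswap p) fun _ _ _ => rfl,
    hrest _ _ (fun _ _ _ => rfl) (hswap q), hrest p q (fun _ _ _ => rfl) fun _ _ _ => rfl]
  simp only [Function.comp_apply, Equiv.swap_apply_left, Equiv.swap_apply_right]
  linear_combination (∏ i ∈ (Finset.univ.erase s).erase t, x (k i, p i, q i)) *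
    swap_rows_swap_cols_same hdet (k s) (k t) (p s) (p t) (q s) (q t)

theorem swap_swap_overlap [Algebra ℂ A] (hdet : ∀ k l, polarDet x k l = 0)
    (hminor : ∀ (a : Fin 3 → Fin 2 × Fin 2) (b : Fin 3 → Fin m),
      (Matrix.of fun i j => x (b j, (a i).1, (a i).2)).det = 0)
    {s t u : Fin n} (hst : s ≠ t) (hsu : s ≠ u) (htu : t ≠ u) :
    MixedDiffVanishes x k (Equiv.swap s t) (Equiv.swap s u) := fun p q => by
  have hrest : ∀ p' q' : Fin n → Fin 2, (∀ i, i ≠ s → i ≠ t → i ≠ u → p' i = p i) →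
      (∀ i, i ≠ s → i ≠ t → i ≠ u → q' i = q i) →
      wordProd x k p' q' = x (k s, p' s, q' s) * x (k t, p' t, q' t) * x (k u, p' u, q' u) *
        ∏ i ∈ ((Finset.univ.erase s).erase t).erase u, x (k i, p i, q i) := by
    intro p' q' hp hq
    rw [wordProd_eq_mul_three x k p' q' hst hsu htu]
    congr 1
    refine Finset.prod_congr rfl fun i hi => ?_
    simp only [Finset.mem_erase] at hi
    rw [hp i hi.2.2.1 hi.2.1 hi.1, hq i hi.2.2.1 hi.2.1 hi.1]
  have hp : ∀ i, i ≠ s → i ≠ t → i ≠ u → (p ∘ Equiv.swap s t) i = p i :=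
    fun i h₁ h₂ _ => by rw [Function.comp_apply, Equiv.swap_apply_of_ne_of_ne h₁ h₂]
  have hq : ∀ i, i ≠ s → i ≠ t → i ≠ u → (q ∘ Equiv.swap s u) i = q i :=
    fun i h₁ _ h₂ => by rw [Function.comp_apply, Equiv.swap_apply_of_ne_of_ne h₁ h₂]
  rw [hrest _ _ hp hq, hrest _ _ hp fun _ _ _ _ => rfl,
    hrest _ _ (fun _ _ _ _ => rfl) hq, hrest p q (fun _ _ _ _ => rfl) fun _ _ _ _ => rfl]
  simp only [Function.comp_apply, Equiv.swap_apply_left, Equiv.swap_apply_right,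
    Equiv.swap_apply_of_ne_of_ne hst.symm htu, Equiv.swap_apply_of_ne_of_ne hsu.symm htu.symm]
  linear_combination (∏ i ∈ ((Finset.univ.erase s).erase t).erase u, x (k i, p i, q i)) *
    swap_rows_swap_cols_overlap hdet hminor (k s) (k t) (k u) (p s) (p t) (p u) (q s) (q t) (q u)

theorem of_polarDet_of_minors [Algebra ℂ A] (hdet : ∀ k l, polarDet x k l = 0)
    (hminor : ∀ (a : Fin 3 → Fin 2 × Fin 2) (b : Fin 3 → Fin m),
      (Matrix.of fun i j => x (b j, (a i).1, (a i).2)).det = 0)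
    (σ τ : Equiv.Perm (Fin n)) : MixedDiffVanishes x k σ τ := by
  induction σ using Equiv.Perm.swap_induction_on with
  | one => exact one_left
  | swap_mul σ s t hst ih =>
    refine mul_left ?_ ih
    -- The transpositions moving `s` generate the symmetric group, so disjoint row and column swaps
    -- need no relation of their own.
    have hstar : ∀ u, s ≠ u → MixedDiffVanishes x k (Equiv.swap s t) (Equiv.swap s u) := by
      intro u hsu
      by_cases htu : t = u
      · exact htu ▸ swap_swap_same hdet hst
      · exact swap_swap_overlap hdet hminor hst hsu htu
    clear ih
    induction τ using Equiv.Perm.swap_induction_on with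
    | one => exact one_right
    | swap_mul τ u v huv ih =>
      refine mul_right ?_ ih
      by_cases hu : s = u
      · exact hu ▸ hstar v (hu ▸ huv)
      by_cases hv : s = v
      · rw [Equiv.swap_comm u]
        exact hv ▸ hstar u (hv ▸ huv.symm)
      -- A swap of `u` and `v` away from `s` is `(s u)(s v)(s u)`.
      rw [← Equiv.swap_mul_swap_mul_swap (Ne.symm hv) huv.symm, Equiv.swap_comm v s]
      exact mul_right (mul_right (hstar u hu) (hstar v hv)) (hstar u hu)

end MixedDiffVanishes

end WordRelations

/-! ### Averaging over permutations of the words. -/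

section Averages

variable {m : ℕ} {A : Type*} [CommRing A]

theorem wordProd_comp_perm (x : TupleVar 2 m → A) {n : ℕ} (k : Fin n → Fin m)
    (p q : Fin n → Fin 2) (ρ : Equiv.Perm (Fin n)) :
    wordProd x (k ∘ ρ) (p ∘ ρ) (q ∘ ρ) = wordProd x k p q :=
  Equiv.prod_comp ρ fun t => x (k t, p t, q t)

/-- The sum of the products obtained by permuting the row word. -/
noncomputable def rowSum (x : TupleVar 2 m → A) {n : ℕ} (k : Fin n → Fin m)
    (p q : Fin n → Fin 2) : A :=
  ∑ σ : Equiv.Perm (Fin n), wordProd x k (p ∘ σ) q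

/-- The sum of the products obtained by permuting the column word. -/
noncomputable def colSum (x : TupleVar 2 m → A) {n : ℕ} (k : Fin n → Fin m)
    (p q : Fin n → Fin 2) : A :=
  ∑ τ : Equiv.Perm (Fin n), wordProd x k p (q ∘ τ)

/-- The sum of the products obtained by permuting the row word and the column word. -/
noncomputable def rowColSum (x : TupleVar 2 m → A) {n : ℕ} (k : Fin n → Fin m)
    (p q : Fin n → Fin 2) : A :=
  ∑ σ : Equiv.Perm (Fin n), ∑ τ : Equiv.Perm (Fin n), wordProd x k (p ∘ σ) (q ∘ τ)

theorem sum_perm_conj {M : Type*} [AddCommMonoid M] {n : ℕ} (π ρ : Equiv.Perm (Fin n))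
    (f : Equiv.Perm (Fin n) → M) : ∑ σ, f (π * σ * ρ⁻¹) = ∑ σ, f σ :=
  Equiv.sum_comp ((Equiv.mulLeft π).trans (Equiv.mulRight ρ⁻¹)) f

theorem comp_perm_eq_conj {α : Type*} {n : ℕ} (f : Fin n → α) (π ρ σ : Equiv.Perm (Fin n)) :
    (f ∘ π) ∘ σ = (f ∘ ⇑(π * σ * ρ⁻¹)) ∘ ρ := by
  funext t
  simp

theorem rowSum_comp_perm (x : TupleVar 2 m → A) {n : ℕ} (k : Fin n → Fin m)
    (p q : Fin n → Fin 2) (π ρ : Equiv.Perm (Fin n)) :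
    rowSum x (k ∘ ρ) (p ∘ π) (q ∘ ρ) = rowSum x k p q := by
  unfold rowSum
  refine Eq.trans ?_ (sum_perm_conj π ρ _)
  refine Finset.sum_congr rfl fun σ _ => ?_
  rw [comp_perm_eq_conj p π ρ, wordProd_comp_perm]

theorem colSum_comp_perm (x : TupleVar 2 m → A) {n : ℕ} (k : Fin n → Fin m)
    (p q : Fin n → Fin 2) (π ρ : Equiv.Perm (Fin n)) :
    colSum x (k ∘ ρ) (p ∘ ρ) (q ∘ π) = colSum x k p q := by
  unfold colSum
  refine Eq.trans ?_ (sum_perm_conj π ρ _)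
  refine Finset.sum_congr rfl fun σ _ => ?_
  rw [comp_perm_eq_conj q π ρ, wordProd_comp_perm]

theorem rowColSum_comp_perm (x : TupleVar 2 m → A) {n : ℕ} (k : Fin n → Fin m)
    (p q : Fin n → Fin 2) (π ρ : Equiv.Perm (Fin n)) :
    rowColSum x (k ∘ ρ) (p ∘ ρ) (q ∘ π) = rowColSum x k p q := by
  unfold rowColSum
  refine Eq.trans ?_ (sum_perm_conj ρ ρ _)
  refine Finset.sum_congr rfl fun σ _ => ?_
  refine Eq.trans ?_ (sum_perm_conj π ρ _)
  refine Finset.sum_congr rfl fun τ _ => ?_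
  rw [comp_perm_eq_conj p ρ ρ, comp_perm_eq_conj q π ρ, wordProd_comp_perm]

/-- Sum the vanishing mixed differences over all pairs of permutations and divide by `(n!)²`. -/
theorem wordProd_eq_averages [Algebra ℂ A] {x : TupleVar 2 m → A} {n : ℕ} {k : Fin n → Fin m}
    (h : ∀ σ τ : Equiv.Perm (Fin n), MixedDiffVanishes x k σ τ) (p q : Fin n → Fin 2) :
    wordProd x k p q = (n.factorial : ℂ)⁻¹ • rowSum x k p q +
      ((n.factorial : ℂ)⁻¹ • colSum x k p q -
        ((n.factorial : ℂ)⁻¹ * (n.factorial : ℂ)⁻¹) • rowColSum x k p q) := by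
  have hN : (n.factorial : ℂ) ≠ 0 := Nat.cast_ne_zero.2 n.factorial_ne_zero
  have hsum : ∑ σ : Equiv.Perm (Fin n), ∑ τ : Equiv.Perm (Fin n),
      (wordProd x k (p ∘ σ) (q ∘ τ) - wordProd x k (p ∘ σ) q - wordProd x k p (q ∘ τ) +
        wordProd x k p q) = 0 :=
    Finset.sum_eq_zero fun σ _ => Finset.sum_eq_zero fun τ _ => h σ τ p q
  simp only [Finset.sum_add_distrib, Finset.sum_sub_distrib, Finset.sum_const, Finset.card_univ,
    Fintype.card_perm, Fintype.card_fin, ← Finset.smul_sum] at hsum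
  change rowColSum x k p q - _ • rowSum x k p q - _ • colSum x k p q + _ = 0 at hsum
  simp only [← Nat.cast_smul_eq_nsmul ℂ] at hsum
  have h' := congrArg (fun z => ((n.factorial : ℂ)⁻¹ * (n.factorial : ℂ)⁻¹) • z) hsum
  simp only [smul_add, smul_sub, smul_smul, smul_zero] at h'
  field_simp at h'
  rw [one_smul] at h'
  field_simp
  linear_combination h'

end Averages

/-! ### Monomials as words, and monomial maps. -/

section Words

variable {ι α β : Type*}

/-- The exponent in the variables `α ⊕ β` that lists the letters of the words `f ∘ w`, `g ∘ w`. -/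
noncomputable def splitExponent (f : ι → α) (g : ι → β) (w : Σ n, Fin n → ι) : α ⊕ β →₀ ℕ :=
  ∑ t, (Finsupp.single (Sum.inl (f (w.2 t))) 1 + Finsupp.single (Sum.inr (g (w.2 t))) 1)

theorem exists_perm_of_count_eq {n : ℕ} {f g : Fin n → α}
    (h : ∀ a, ∑ t, Finsupp.single (f t) 1 a = ∑ t, Finsupp.single (g t) 1 a) :
    ∃ σ : Equiv.Perm (Fin n), g = f ∘ σ := by
  classical
  have e : ∀ a, Nonempty ({t // g t = a} ≃ {t // f t = a}) := fun a => by
    refine ⟨Fintype.equivOfCardEq ?_⟩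
    have ha := h a
    simp only [Finsupp.single_apply, Finset.sum_boole, Nat.cast_id] at ha
    rw [Fintype.card_subtype, Fintype.card_subtype, ha]
  exact ⟨Equiv.ofFiberEquiv fun a => (e a).some,
    _root_.funext fun t => (Equiv.ofFiberEquiv_map (fun a => (e a).some) t).symm⟩

theorem length_eq_of_splitExponent_eq {f : ι → α} {g : ι → β} {w w' : Σ n, Fin n → ι}
    (h : splitExponent f g w = splitExponent f g w') : w.1 = w'.1 := by
  have h' := congrArg Finsupp.degree h
  simp only [splitExponent, map_sum, map_add, Finsupp.degree_single, Finset.sum_const,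
    Finset.card_univ, Fintype.card_fin, smul_eq_mul] at h'
  omega

theorem exists_perm_of_splitExponent_eq {f : ι → α} {g : ι → β} {n : ℕ} {w w' : Fin n → ι}
    (h : splitExponent f g ⟨n, w⟩ = splitExponent f g ⟨n, w'⟩) :
    (∃ π : Equiv.Perm (Fin n), f ∘ w' = (f ∘ w) ∘ π) ∧
      ∃ ρ : Equiv.Perm (Fin n), g ∘ w' = (g ∘ w) ∘ ρ := by
  classical
  refine ⟨exists_perm_of_count_eq fun a => ?_, exists_perm_of_count_eq fun b => ?_⟩
  · have h' := DFunLike.congr_fun h (Sum.inl a)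
    simpa [splitExponent, Finsupp.single_apply] using h'
  · have h' := DFunLike.congr_fun h (Sum.inr b)
    simpa [splitExponent, Finsupp.single_apply] using h'

theorem exists_word (s : ι →₀ ℕ) :
    ∃ w : Σ n, Fin n → ι, s = ∑ t, Finsupp.single (w.2 t) 1 := by
  induction s using Finsupp.induction_linear with
  | zero => exact ⟨⟨0, Fin.elim0⟩, by simp⟩
  | add s s' hs hs' =>
    obtain ⟨⟨n, w⟩, rfl⟩ := hs
    obtain ⟨⟨n', w'⟩, rfl⟩ := hs'
    exact ⟨⟨n + n', Fin.append w w'⟩, by simp [Fin.sum_univ_add]⟩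
  | single i c => exact ⟨⟨c, fun _ => i⟩, by simp⟩

/-- The monomial map `X i ↦ X (f i) * X (g i)`. -/
noncomputable def splitHom (f : ι → α) (g : ι → β) :
    MvPolynomial ι ℂ →ₐ[ℂ] MvPolynomial (α ⊕ β) ℂ :=
  aeval fun i => X (Sum.inl (f i)) * X (Sum.inr (g i))

theorem monomial_word (w : Σ n, Fin n → ι) :
    monomial (∑ t, Finsupp.single (w.2 t) 1) (1 : ℂ) = ∏ t, X (w.2 t) :=
  monomial_sum_one _ _

theorem splitHom_monomial_word (f : ι → α) (g : ι → β) (w : Σ n, Fin n → ι) :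
    splitHom f g (monomial (∑ t, Finsupp.single (w.2 t) 1) 1) =
      monomial (splitExponent f g w) 1 := by
  rw [monomial_word, map_prod, splitExponent, monomial_sum_one]
  refine Finset.prod_congr rfl fun t _ => ?_
  rw [splitHom, aeval_X, X, X, monomial_mul, one_mul]

end Words

/-! ### Factoring through the two parametrizations. -/

section Vanishing

variable {m : ℕ} {A : Type*} [CommRing A] [Algebra ℂ A]

/-- The parametrization of the tuples of rank one matrices with a common column space. -/
noncomputable def rowSplit (m : ℕ) :
    MvPolynomial (TupleVar 2 m) ℂ →ₐ[ℂ] MvPolynomial (Fin 2 ⊕ Fin m × Fin 2) ℂ :=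
  splitHom (fun v => v.2.1) fun v => (v.1, v.2.2)

/-- The parametrization of the tuples of rank one matrices with a common row space. -/
noncomputable def colSplit (m : ℕ) :
    MvPolynomial (TupleVar 2 m) ℂ →ₐ[ℂ] MvPolynomial (Fin 2 ⊕ Fin m × Fin 2) ℂ :=
  splitHom (fun v => v.2.2) fun v => (v.1, v.2.1)

/-- Two words have the same `rowSplit` monomial exactly when their row words, and separately their
words of (matrix, column) pairs, agree up to permutation. Row averages are invariant under such
changes, and symmetrically for `colSplit`. -/
theorem algHom_eq_zero_of_rowSplit_of_colSplit (Φ : MvPolynomial (TupleVar 2 m) ℂ →ₐ[ℂ] A)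
    (hdet : ∀ k l, polarDet (fun v => Φ (X v)) k l = 0)
    (hminor : ∀ (a : Fin 3 → Fin 2 × Fin 2) (b : Fin 3 → Fin m),
      (Matrix.of fun i j => Φ (X (b j, (a i).1, (a i).2))).det = 0)
    {f : MvPolynomial (TupleVar 2 m) ℂ} (hrow : rowSplit m f = 0) (hcol : colSplit m f = 0) :
    Φ f = 0 := by
  set x : TupleVar 2 m → A := fun v => Φ (X v) with hx
  let kw (w : Σ n, Fin n → TupleVar 2 m) : Fin w.1 → Fin m := fun t => (w.2 t).1
  let pw (w : Σ n, Fin n → TupleVar 2 m) : Fin w.1 → Fin 2 := fun t => (w.2 t).2.1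
  let qw (w : Σ n, Fin n → TupleVar 2 m) : Fin w.1 → Fin 2 := fun t => (w.2 t).2.2
  let F₀ (w : Σ n, Fin n → TupleVar 2 m) : A :=
    (w.1.factorial : ℂ)⁻¹ • rowSum x (kw w) (pw w) (qw w)
  let G₀ (w : Σ n, Fin n → TupleVar 2 m) : A :=
    (w.1.factorial : ℂ)⁻¹ • colSum x (kw w) (pw w) (qw w) -
      ((w.1.factorial : ℂ)⁻¹ * (w.1.factorial : ℂ)⁻¹) • rowColSum x (kw w) (pw w) (qw w)
  have hF : Function.FactorsThrough F₀
      (splitExponent (fun v : TupleVar 2 m => v.2.1) fun v => (v.1, v.2.2)) := by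
    rintro ⟨n, w⟩ ⟨n', w'⟩ h
    obtain rfl : n = n' := length_eq_of_splitExponent_eq h
    obtain ⟨⟨π, hπ⟩, ρ, hρ⟩ := exists_perm_of_splitExponent_eq h
    have h₁ : kw ⟨n, w'⟩ = kw ⟨n, w⟩ ∘ ρ :=
      congrArg (fun (h : Fin n → Fin m × Fin 2) t => (h t).1) hρ
    have h₂ : qw ⟨n, w'⟩ = qw ⟨n, w⟩ ∘ ρ :=
      congrArg (fun (h : Fin n → Fin m × Fin 2) t => (h t).2) hρ
    have h₃ : pw ⟨n, w'⟩ = pw ⟨n, w⟩ ∘ π := hπ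
    simp only [F₀]
    rw [h₁, h₂, h₃, rowSum_comp_perm]
  have hG : Function.FactorsThrough G₀
      (splitExponent (fun v : TupleVar 2 m => v.2.2) fun v => (v.1, v.2.1)) := by
    rintro ⟨n, w⟩ ⟨n', w'⟩ h
    obtain rfl : n = n' := length_eq_of_splitExponent_eq h
    obtain ⟨⟨π, hπ⟩, ρ, hρ⟩ := exists_perm_of_splitExponent_eq h
    have h₁ : kw ⟨n, w'⟩ = kw ⟨n, w⟩ ∘ ρ :=
      congrArg (fun (h : Fin n → Fin m × Fin 2) t => (h t).1) hρ
    have h₂ : pw ⟨n, w'⟩ = pw ⟨n, w⟩ ∘ ρ :=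
      congrArg (fun (h : Fin n → Fin m × Fin 2) t => (h t).2) hρ
    have h₃ : qw ⟨n, w'⟩ = qw ⟨n, w⟩ ∘ π := hπ
    simp only [G₀]
    rw [h₁, h₂, h₃, colSum_comp_perm, rowColSum_comp_perm]
  -- The value 0 on monomials outside the image of the monomial map is arbitrary.
  let F := (basisMonomials (Fin 2 ⊕ Fin m × Fin 2) ℂ).constr ℂ
    (Function.extend (splitExponent (fun v : TupleVar 2 m => v.2.1) fun v => (v.1, v.2.2)) F₀ 0)
  let G := (basisMonomials (Fin 2 ⊕ Fin m × Fin 2) ℂ).constr ℂ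
    (Function.extend (splitExponent (fun v : TupleVar 2 m => v.2.2) fun v => (v.1, v.2.1)) G₀ 0)
  have key : Φ.toLinearMap =
      F ∘ₗ (rowSplit m).toLinearMap + G ∘ₗ (colSplit m).toLinearMap := by
    refine (basisMonomials (TupleVar 2 m) ℂ).ext fun s => ?_
    obtain ⟨w, rfl⟩ := exists_word s
    simp only [coe_basisMonomials, LinearMap.add_apply, LinearMap.comp_apply,
      AlgHom.toLinearMap_apply, rowSplit, colSplit, splitHom_monomial_word]
    have hF' := (basisMonomials (Fin 2 ⊕ Fin m × Fin 2) ℂ).constr_basis ℂ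
      (Function.extend (splitExponent (fun v : TupleVar 2 m => v.2.1) fun v => (v.1, v.2.2)) F₀ 0)
      (splitExponent (fun v : TupleVar 2 m => v.2.1) (fun v => (v.1, v.2.2)) w)
    have hG' := (basisMonomials (Fin 2 ⊕ Fin m × Fin 2) ℂ).constr_basis ℂ
      (Function.extend (splitExponent (fun v : TupleVar 2 m => v.2.2) fun v => (v.1, v.2.1)) G₀ 0)
      (splitExponent (fun v : TupleVar 2 m => v.2.2) (fun v => (v.1, v.2.1)) w)
    rw [coe_basisMonomials, hF.extend_apply] at hF'
    rw [coe_basisMonomials, hG.extend_apply] at hG'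
    rw [monomial_word, map_prod]
    refine Eq.trans ?_ (congrArg₂ (· + ·) hF' hG').symm
    exact wordProd_eq_averages (fun σ τ => .of_polarDet_of_minors hdet hminor σ τ) (pw w) (qw w)
  have h := LinearMap.congr_fun key f
  simpa [hrow, hcol] using h

end Vanishing

/-! ### The variety of singular tuples and generators of its ideal. -/

section SingularTuples

variable {m : ℕ} {A B : Type*} [CommRing A] [CommRing B]

/-- The determinant of a linear combination of the `2 × 2` matrices with coordinate vector `x`. -/
def detComb (x : TupleVar 2 m → A) (c : Fin m → A) : A :=
  (∑ k, c k • tupleMatrix x k).det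

theorem detForm_eq_detComb (c : Fin m → ℂ) : detForm 2 m c = detComb X fun k => C (c k) := rfl

theorem detComb_eq (x : TupleVar 2 m → A) (c : Fin m → A) :
    detComb x c = (∑ k, c k * x (k, 0, 0)) * (∑ k, c k * x (k, 1, 1)) -
      (∑ k, c k * x (k, 0, 1)) * ∑ k, c k * x (k, 1, 0) := by
  simp [detComb, Matrix.det_fin_two, Matrix.sum_apply, tupleMatrix]

theorem map_detComb (φ : A →+* B) (x : TupleVar 2 m → A) (c : Fin m → A) :
    φ (detComb x c) = detComb (fun v => φ (x v)) fun k => φ (c k) := by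
  simp [detComb_eq]

theorem detComb_single (x : TupleVar 2 m → A) (k : Fin m) :
    detComb x (Pi.single k 1) = x (k, 0, 0) * x (k, 1, 1) - x (k, 0, 1) * x (k, 1, 0) := by
  simp [detComb_eq, Pi.single_apply]

theorem detComb_single_add_single (x : TupleVar 2 m → A) (k l : Fin m) :
    detComb x (Pi.single k 1 + Pi.single l 1) =
      detComb x (Pi.single k 1) + detComb x (Pi.single l 1) + polarDet x k l := by
  rw [detComb_single, detComb_single, detComb_eq]
  simp only [Pi.add_apply, Pi.single_apply, add_mul, ite_mul, one_mul, zero_mul,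
    Finset.sum_add_distrib, Finset.sum_ite_eq', Finset.mem_univ, if_true, polarDet]
  ring

theorem two_mul_detComb (x : TupleVar 2 m → A) (c : Fin m → A) :
    2 * detComb x c = ∑ k, ∑ l, c k * c l * polarDet x k l := by
  have hprod : ∀ f g : Fin m → A, (∑ k, c k * f k) * ∑ k, c k * g k =
      ∑ k, ∑ l, c k * c l * (f k * g l) := fun f g => by
    rw [Finset.sum_mul_sum]
    exact Finset.sum_congr rfl fun k _ => Finset.sum_congr rfl fun l _ => by ring
  rw [two_mul]
  nth_rewrite 2 [detComb_eq]
  rw [detComb_eq, mul_comm (∑ k, c k * x (k, 0, 0)), mul_comm (∑ k, c k * x (k, 0, 1))]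
  nth_rewrite 3 [mul_comm]
  nth_rewrite 4 [mul_comm]
  simp only [hprod, ← Finset.sum_sub_distrib, ← Finset.sum_add_distrib, polarDet]
  exact Finset.sum_congr rfl fun k _ => Finset.sum_congr rfl fun l _ => by ring

/-- The rational vectors `e_k`, `e_l` and `e_k + e_l` already determine the polar form, so rational
coefficients impose the same conditions as complex ones. -/
theorem polarDet_eq_zero_of_mem_singVariety {x : TupleVar 2 m → ℂ} (hx : x ∈ singVariety 2 m)
    (k l : Fin m) : polarDet x k l = 0 := by
  have h : ∀ c : Fin m → ℚ, detComb x (fun k => (c k : ℂ)) = 0 := hx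
  have hsingle : ∀ k : Fin m, (fun i => (((Pi.single k 1 : Fin m → ℚ) i : ℚ) : ℂ)) =
      Pi.single k 1 := fun k => by
    ext i
    by_cases hi : i = k <;> simp [hi]
  have hk := h (Pi.single k 1)
  have hl := h (Pi.single l 1)
  have hkl := h (Pi.single k 1 + Pi.single l 1)
  have hadd : (fun i => (((Pi.single k 1 + Pi.single l 1 : Fin m → ℚ) i : ℚ) : ℂ)) =
      Pi.single k 1 + Pi.single l 1 := by
    rw [← hsingle k, ← hsingle l]
    ext i
    simp
  rw [hsingle] at hk hl
  rw [hadd, detComb_single_add_single, hk, hl] at hkl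
  simpa using hkl

theorem detComb_eq_zero_of_mem_singVariety {x : TupleVar 2 m → ℂ} (hx : x ∈ singVariety 2 m)
    (c : Fin m → ℂ) : detComb x c = 0 := by
  have h := two_mul_detComb x c
  simpa [polarDet_eq_zero_of_mem_singVariety hx] using h

theorem mem_singVariety_of_eq_mul {x : TupleVar 2 m → ℂ} {u : Fin 2 → ℂ}
    {v : Fin m → Fin 2 → ℂ} (hx : (∀ k i j, x (k, i, j) = u i * v k j) ∨
      ∀ k i j, x (k, i, j) = u j * v k i) : x ∈ singVariety 2 m := by
  intro c
  change detComb x (fun k => (c k : ℂ)) = 0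
  have h := two_mul_detComb x fun k => (c k : ℂ)
  have h0 : ∀ k l, polarDet x k l = 0 := fun k l => by
    rcases hx with hx | hx <;> simp only [polarDet, hx] <;> ring
  simpa [h0] using h

theorem rowSplit_eq_zero {f : MvPolynomial (TupleVar 2 m) ℂ} (hf : f ∈ singIdeal 2 m) :
    rowSplit m f = 0 := by
  refine MvPolynomial.funext fun z => ?_
  have h := hf (fun v => z (Sum.inl v.2.1) * z (Sum.inr (v.1, v.2.2)))
    (mem_singVariety_of_eq_mul (u := fun i => z (Sum.inl i)) (v := fun k j => z (Sum.inr (k, j)))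
      (Or.inl fun _ _ _ => rfl))
  rw [map_zero, ← h, rowSplit, splitHom, ← coe_aeval_eq_eval, RingHom.coe_coe, ← AlgHom.comp_apply,
    comp_aeval]
  simp

theorem colSplit_eq_zero {f : MvPolynomial (TupleVar 2 m) ℂ} (hf : f ∈ singIdeal 2 m) :
    colSplit m f = 0 := by
  refine MvPolynomial.funext fun z => ?_
  have h := hf (fun v => z (Sum.inl v.2.2) * z (Sum.inr (v.1, v.2.1)))
    (mem_singVariety_of_eq_mul (u := fun i => z (Sum.inl i)) (v := fun k j => z (Sum.inr (k, j)))
      (Or.inr fun _ _ _ => rfl))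
  rw [map_zero, ← h, colSplit, splitHom, ← coe_aeval_eq_eval, RingHom.coe_coe, ← AlgHom.comp_apply,
    comp_aeval]
  simp

theorem detForm_mem_singIdeal (c : Fin m → ℂ) : detForm 2 m c ∈ singIdeal 2 m := fun x hx => by
  have h := map_detComb (aeval x : MvPolynomial (TupleVar 2 m) ℂ →ₐ[ℂ] ℂ).toRingHom X
    fun k => C (c k)
  rw [detForm_eq_detComb]
  refine h.trans ?_
  simpa using detComb_eq_zero_of_mem_singVariety hx c

/-- With `S = J ⊗ J` the invertible Gram matrix of the polar form, isotropy reads `Nᵀ S N = 0`. This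
forces `2 · rank N ≤ 4`, whereas a nonzero minor would give rank 3. -/
theorem minor_eq_zero_of_mem_singVariety {x : TupleVar 2 m → ℂ} (hx : x ∈ singVariety 2 m)
    (a : Fin 3 → Fin 2 × Fin 2) (b : Fin 3 → Fin m) :
    (Matrix.of fun i j => x (b j, (a i).1, (a i).2)).det = 0 := by
  by_contra hdet
  let N : Matrix (Fin 2 × Fin 2) (Fin 3) ℂ := Matrix.of fun ij k => x (b k, ij.1, ij.2)
  let J : Matrix (Fin 2) (Fin 2) ℂ := !![0, 1; -1, 0]
  let S : Matrix (Fin 2 × Fin 2) (Fin 2 × Fin 2) ℂ := Matrix.kroneckerMap (· * ·) J J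
  have hS : IsUnit S.det := by
    rw [Matrix.det_kronecker]
    simp [J, Matrix.det_fin_two]
  have hNS : N.transpose * (S * N) = 0 := by
    ext k l
    have h := polarDet_eq_zero_of_mem_singVariety hx (b k) (b l)
    simp only [polarDet] at h
    simp only [Matrix.mul_apply, Fintype.sum_prod_type, Fin.sum_univ_two, N, S, J,
      Matrix.transpose_apply, Matrix.of_apply, Matrix.kroneckerMap_apply, Matrix.cons_val',
      Matrix.cons_val, Matrix.zero_apply]
    linear_combination h
  have hrank := Matrix.rank_add_rank_le_card_of_mul_eq_zero hNS
  rw [Matrix.rank_mul_eq_right_of_isUnit_det _ _ hS, Matrix.rank_transpose] at hrank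
  have h3 : (N.submatrix a (Equiv.refl (Fin 3))).rank = 3 := by
    have hunit : IsUnit (N.submatrix a (Equiv.refl (Fin 3))) :=
      (Matrix.isUnit_iff_isUnit_det _).2 (isUnit_iff_ne_zero.2 hdet)
    rw [Matrix.rank_of_isUnit _ hunit, Fintype.card_fin]
  have hle := N.rank_submatrix_le a (Equiv.refl (Fin 3))
  simp only [Fintype.card_prod, Fintype.card_fin] at hrank
  omega

theorem flatteningMinors_subset_singIdeal :
    flatteningMinors 2 m 3 ⊆ (singIdeal 2 m : Set (MvPolynomial (TupleVar 2 m) ℂ)) := by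
  rintro _ ⟨a, b, rfl⟩ x hx
  rw [AlgHom.map_det]
  refine Eq.trans (congrArg Matrix.det ?_) (minor_eq_zero_of_mem_singVariety hx a b)
  ext i j
  simp [flattening]

theorem polarDet_X_eq (k l : Fin m) :
    polarDet (X : TupleVar 2 m → MvPolynomial (TupleVar 2 m) ℂ) k l =
      detForm 2 m (Pi.single k 1 + Pi.single l 1) - detForm 2 m (Pi.single k 1) -
        detForm 2 m (Pi.single l 1) := by
  have hsingle : ∀ k : Fin m, (fun i => C ((Pi.single k 1 : Fin m → ℂ) i)) =
      (Pi.single k 1 : Fin m → MvPolynomial (TupleVar 2 m) ℂ) := fun k => by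
    ext1 i
    by_cases hi : i = k <;> simp [hi]
  have hadd : (fun i => C ((Pi.single k 1 + Pi.single l 1 : Fin m → ℂ) i)) =
      (Pi.single k 1 + Pi.single l 1 : Fin m → MvPolynomial (TupleVar 2 m) ℂ) := by
    rw [← hsingle k, ← hsingle l]
    ext1 i
    simp
  rw [detForm_eq_detComb, detForm_eq_detComb, detForm_eq_detComb, hadd, hsingle, hsingle,
    detComb_single_add_single]
  ring

theorem singIdeal_eq_span_detForm_union_minors :
    singIdeal 2 m = Ideal.span (Set.range (detForm 2 m) ∪ flatteningMinors 2 m 3) := by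
  set K : Ideal (MvPolynomial (TupleVar 2 m) ℂ) :=
    Ideal.span (Set.range (detForm 2 m) ∪ flatteningMinors 2 m 3) with hK
  refine le_antisymm (fun f hf => ?_) (Ideal.span_le.2 (Set.union_subset
    (Set.range_subset_iff.2 detForm_mem_singIdeal) flatteningMinors_subset_singIdeal))
  rw [← Ideal.Quotient.eq_zero_iff_mem, ← Ideal.Quotient.mkₐ_eq_mk ℂ]
  refine algHom_eq_zero_of_rowSplit_of_colSplit _ (fun k l => ?_) (fun a b => ?_)
    (rowSplit_eq_zero hf) (colSplit_eq_zero hf)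
  · have hmem : polarDet X k l ∈ K := by
      have h : ∀ c, detForm 2 m c ∈ K := fun c => Ideal.subset_span (Or.inl ⟨c, rfl⟩)
      rw [polarDet_X_eq]
      exact K.sub_mem (K.sub_mem (h _) (h _)) (h _)
    rw [← Ideal.Quotient.eq_zero_iff_mem] at hmem
    rw [← hmem]
    simp [polarDet]
  -- The generators use injective choices of rows and columns; any other choice repeats a row or a
  -- column.
  · by_cases ha : Function.Injective a
    · by_cases hb : Function.Injective b
      · have hmem : ((flattening 2 m).submatrix a b).det ∈ K :=
          Ideal.subset_span (Or.inr ⟨⟨a, ha⟩, ⟨b, hb⟩, rfl⟩)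
        rw [← Ideal.Quotient.eq_zero_iff_mem, RingHom.map_det] at hmem
        rw [← hmem]
        rfl
      · obtain ⟨i, j, hij, hne⟩ := Function.not_injective_iff.1 hb
        exact Matrix.det_zero_of_column_eq hne fun r => by simp [hij]
    · obtain ⟨i, j, hij, hne⟩ := Function.not_injective_iff.1 ha
      exact Matrix.det_zero_of_row_eq hne (by ext r; simp [hij])

end SingularTuples

/-! ### Quadratic part and radical. -/

section Components

variable {m : ℕ}

theorem detForm_mem_homogeneousSubmodule (c : Fin m → ℂ) :
    detForm 2 m c ∈ homogeneousSubmodule (TupleVar 2 m) ℂ 2 := by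
  have hlin : ∀ i j : Fin 2, (∑ k, C (c k) * X (k, i, j) :
      MvPolynomial (TupleVar 2 m) ℂ).IsHomogeneous 1 := fun i j =>
    IsHomogeneous.sum _ _ _ fun k _ => isHomogeneous_C_mul_X _ _
  rw [detForm_eq_detComb, detComb_eq]
  exact ((hlin 0 0).mul (hlin 1 1)).sub ((hlin 0 1).mul (hlin 1 0))

theorem flatteningMinors_subset_homogeneousSubmodule (n r : ℕ) :
    flatteningMinors n m r ⊆ (homogeneousSubmodule (TupleVar n m) ℂ r : Set _) := by
  rintro _ ⟨a, b, rfl⟩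
  rw [Matrix.det_apply]
  refine Submodule.sum_mem _ fun σ _ => ?_
  rw [Units.smul_def]
  refine (homogeneousSubmodule (TupleVar n m) ℂ r).toAddSubgroup.zsmul_mem ?_ _
  have h := IsHomogeneous.prod (Finset.univ : Finset (Fin r))
    (fun i => (flattening n m).submatrix a b (σ i) i) (fun _ => 1)
    fun i _ => isHomogeneous_X ℂ _
  simpa using h

theorem homogeneousComponent_mem_span_of_mem_span {ι : Type*} {d : ℕ}
    {S T : Set (MvPolynomial ι ℂ)} (hS : ∀ f ∈ S, f.IsHomogeneous d)
    (hT : ∀ f ∈ T, ∃ e, d < e ∧ f.IsHomogeneous e) {f : MvPolynomial ι ℂ}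
    (hf : f ∈ Ideal.span (S ∪ T)) :
    homogeneousComponent d f ∈ Submodule.span ℂ S := by
  let _ := gradedAlgebra (σ := ι) (R := ℂ)
  have hcomp : ∀ e (g : MvPolynomial ι ℂ), homogeneousComponent e g =
      DirectSum.decompose (homogeneousSubmodule ι ℂ) g e := fun e g =>
    (decomposition.decompose'_apply g e).symm
  -- The extra factor `g` makes the claim stable under multiplication by ring elements. On a
  -- generator from `S` only the constant term of `g` contributes, and on one from `T` nothing does.
  suffices h : ∀ g, homogeneousComponent d (f * g) ∈ Submodule.span ℂ S by
    simpa using h 1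
  refine Submodule.span_induction (p := fun f _ => ∀ g, homogeneousComponent d (f * g) ∈
    Submodule.span ℂ S) ?_ ?_ ?_ ?_ hf
  · rintro f (hfS | hfT) g
    · rw [hcomp, DirectSum.coe_decompose_mul_of_left_mem_of_le (homogeneousSubmodule ι ℂ)
        (hS f hfS) le_rfl, Nat.sub_self, ← hcomp, homogeneousComponent_zero, mul_comm, ← smul_eq_C_mul]
      exact Submodule.smul_mem _ _ (Submodule.subset_span hfS)
    · obtain ⟨e, hde, he⟩ := hT f hfT
      rw [hcomp, DirectSum.coe_decompose_mul_of_left_mem_of_not_le (homogeneousSubmodule ι ℂ)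
        he hde.not_ge]
      exact Submodule.zero_mem _
  · intro g
    simp
  · intro f f' _ _ hf hf' g
    rw [add_mul, map_add]
    exact Submodule.add_mem _ (hf g) (hf' g)
  · intro r f _ hf g
    rw [smul_eq_mul, mul_comm r f, mul_assoc]
    exact hf (r * g)

theorem singIdealComponent_two_eq_span_detForm :
    singIdealComponent 2 m 2 = Submodule.span ℂ (Set.range (detForm 2 m)) := by
  refine le_antisymm ?_ (Submodule.span_le.2 ?_)
  · rintro f ⟨hf, hf2⟩
    have hf' : f ∈ Ideal.span (Set.range (detForm 2 m) ∪ flatteningMinors 2 m 3) :=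
      singIdeal_eq_span_detForm_union_minors (m := m) ▸ hf
    have h := homogeneousComponent_mem_span_of_mem_span
      (Set.forall_mem_range.2 detForm_mem_homogeneousSubmodule)
      (fun f hf => ⟨3, Nat.lt_succ_self 2, flatteningMinors_subset_homogeneousSubmodule 2 3 hf⟩)
      hf'
    rwa [homogeneousComponent_of_mem hf2, if_pos rfl] at h
  · rintro _ ⟨c, rfl⟩
    exact ⟨detForm_mem_singIdeal c, detForm_mem_homogeneousSubmodule c⟩

theorem span_singIdealComponent_two :
    Ideal.span (singIdealComponent 2 m 2 : Set (MvPolynomial (TupleVar 2 m) ℂ)) =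
      Ideal.span (Set.range (detForm 2 m)) := by
  rw [singIdealComponent_two_eq_span_detForm]
  exact Submodule.span_span_of_tower ℂ _ _

theorem zeroLocus_span_detForm :
    zeroLocus ℂ (Ideal.span (Set.range (detForm 2 m))) = singVariety 2 m := by
  ext x
  rw [zeroLocus_span]
  refine ⟨fun h c => ?_, fun hx => Set.forall_mem_range.2 fun c => detForm_mem_singIdeal c x hx⟩
  have hc := h _ ⟨fun k => (c k : ℂ), rfl⟩
  rw [detForm_eq_detComb] at hc
  have hmap := map_detComb (aeval x : MvPolynomial (TupleVar 2 m) ℂ →ₐ[ℂ] ℂ).toRingHom X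
    fun k => C (c k : ℂ)
  have hzero := hmap.symm.trans hc
  change detComb x _ = 0
  simpa using hzero

theorem singIdeal_eq_radical :
    singIdeal 2 m = (Ideal.span (Set.range (detForm 2 m))).radical := by
  rw [← vanishingIdeal_zeroLocus_eq_radical (K := ℂ), zeroLocus_span_detForm, singIdeal]

end Components

/-! ### A nonreduced point separating the quadrics from the minors. -/

section NotRadical

/-- The element `ε₁ + ε₂` of `ℂ[ε₁, ε₂] / (ε₁², ε₂²)`. -/
def dualSum : DualNumber (DualNumber ℂ) :=
  TrivSqZeroExt.inl (TrivSqZeroExt.inr 1) + TrivSqZeroExt.inr (TrivSqZeroExt.inl 1)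

/-- The element `i (ε₁ - ε₂)` of `ℂ[ε₁, ε₂] / (ε₁², ε₂²)`. -/
noncomputable def dualDiff : DualNumber (DualNumber ℂ) :=
  TrivSqZeroExt.inl (TrivSqZeroExt.inr Complex.I) +
    TrivSqZeroExt.inr (TrivSqZeroExt.inl (-Complex.I))

theorem dualSum_mul_dualDiff : dualSum * dualDiff = 0 := by
  ext <;> simp [dualSum, dualDiff]

theorem dualDiff_mul_dualDiff : dualDiff * dualDiff = dualSum * dualSum := by
  ext <;> simp [dualSum, dualDiff]

theorem two_mul_dualSum_mul_dualSum_ne_zero : 2 * (dualSum * dualSum) ≠ 0 := by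
  intro h
  have h' := congrArg (fun z : DualNumber (DualNumber ℂ) => z.snd.snd) h
  rw [two_mul] at h'
  norm_num [dualSum] at h'

/-- A tuple of three `2 × 2` matrices, spread over the positions `k₀`, `k₁`, `k₂`, that annihilates
the quadrics `polarDet` as soon as `s * d = 0` and `d * d = s * s`. -/
def nilTuple {A : Type*} [CommRing A] {m : ℕ} (s d : A) (k₀ k₁ k₂ : Fin m)
    (v : TupleVar 2 m) : A :=
  if v.1 = k₀ then !![1, 0; 0, 0] v.2.1 v.2.2
  else if v.1 = k₁ then !![0, s; -d, 0] v.2.1 v.2.2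
  else if v.1 = k₂ then !![0, d; s, 0] v.2.1 v.2.2
  else 0

theorem polarDet_nilTuple {A : Type*} [CommRing A] {m : ℕ} {s d : A} (h₁ : s * d = 0)
    (h₂ : d * d = s * s) (k₀ k₁ k₂ k l : Fin m) : polarDet (nilTuple s d k₀ k₁ k₂) k l = 0 := by
  simp only [polarDet, nilTuple, Matrix.of_apply, Matrix.cons_val', Matrix.cons_val]
  split_ifs <;> first
    | ring1
    | linear_combination 2 * h₁
    | linear_combination -2 * h₁
    | linear_combination h₂

theorem not_isRadical_span_detForm {m : ℕ} (hm : 3 ≤ m) :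
    ¬ (Ideal.span (Set.range (detForm 2 m))).IsRadical := by
  intro hrad
  let k : Fin 3 ↪ Fin m := Fin.castLEEmb hm
  have hk : ∀ {i j : Fin 3}, i ≠ j → k i ≠ k j := fun h => k.injective.ne h
  -- At `nilTuple s d` this minor equals `s² + d² = 2s²`, which is `4ε₁ε₂` for `s = ε₁ + ε₂`.
  let a : Fin 3 ↪ Fin 2 × Fin 2 := ⟨![(0, 0), (0, 1), (1, 0)], by decide⟩
  have hmem : ((flattening 2 m).submatrix a k).det ∈ Ideal.span (Set.range (detForm 2 m)) := by
    rw [← hrad.radical, ← singIdeal_eq_radical]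
    exact flatteningMinors_subset_singIdeal ⟨a, k, rfl⟩
  let Φ : MvPolynomial (TupleVar 2 m) ℂ →ₐ[ℂ] DualNumber (DualNumber ℂ) :=
    aeval (nilTuple dualSum dualDiff (k 0) (k 1) (k 2))
  have hker : Ideal.span (Set.range (detForm 2 m)) ≤ RingHom.ker Φ := by
    refine Ideal.span_le.2 (Set.range_subset_iff.2 fun c => ?_)
    have h2 : Φ (2 * detForm 2 m c) = 0 := by
      rw [detForm_eq_detComb, two_mul_detComb, map_sum]
      refine Finset.sum_eq_zero fun i _ => ?_
      rw [map_sum]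
      refine Finset.sum_eq_zero fun j _ => ?_
      have hΦ : Φ (polarDet X i j) = polarDet (nilTuple dualSum dualDiff (k 0) (k 1) (k 2)) i j := by
        simp [polarDet, Φ]
      rw [map_mul, hΦ, polarDet_nilTuple dualSum_mul_dualDiff dualDiff_mul_dualDiff, mul_zero]
    have h2' : (2 : ℂ) • Φ (detForm 2 m c) = 0 := by
      rw [← map_smul, smul_eq_C_mul, map_ofNat, h2]
    simpa using h2'
  have hzero : Φ ((flattening 2 m).submatrix a k).det = 0 := hker hmem
  refine two_mul_dualSum_mul_dualSum_ne_zero ?_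
  rw [← hzero, Matrix.det_fin_three]
  have h01 := hk (show (1 : Fin 3) ≠ 0 by decide)
  have h02 := hk (show (2 : Fin 3) ≠ 0 by decide)
  have h12 := hk (show (2 : Fin 3) ≠ 1 by decide)
  simp only [map_add, map_sub, map_mul, Matrix.submatrix_apply, flattening,
    Matrix.of_apply, Φ, aeval_X, a, Function.Embedding.coeFn_mk, Matrix.cons_val, nilTuple, h01,
    h02, h12, if_true, if_false, Matrix.cons_val']
  linear_combination -dualDiff_mul_dualDiff

end NotRadical

theorem theorem3p1 (m : ℕ) (hm : 3 ≤ m) :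
    singIdealComponent 2 m 2 = Submodule.span ℂ (Set.range (detForm 2 m)) ∧
    ¬ (Ideal.span (singIdealComponent 2 m 2 : Set (MvPolynomial (TupleVar 2 m) ℂ))).IsRadical ∧
    singIdeal 2 m =
      (Ideal.span (singIdealComponent 2 m 2 : Set (MvPolynomial (TupleVar 2 m) ℂ))).radical ∧
    singIdeal 2 m =
      Ideal.span ((singIdealComponent 2 m 2 : Set (MvPolynomial (TupleVar 2 m) ℂ)) ∪
        flatteningMinors 2 m 3) := by
  refine ⟨singIdealComponent_two_eq_span_detForm, ?_, ?_, ?_⟩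
  · rw [span_singIdealComponent_two]
    exact not_isRadical_span_detForm hm
  · rw [span_singIdealComponent_two]
    exact singIdeal_eq_radical
  · rw [Ideal.span_union, span_singIdealComponent_two, ← Ideal.span_union]
    exact singIdeal_eq_span_detForm_union_minors
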